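/- **Setting.** An integer linear inequality in the variables $z=(z_1,\dots,z_n)$ is $Az\ge b$ with $A\in\mathbb Z^n$, $b\in\mathbb Z$. A CNF $F=C_1\wedge\dots\wedge C_m$ over $z_1,\dots,z_n$ is identified with the system consisting of the inequalities $\sum_{z_i\in C_k}z_i+\sum_{\neg z_i\in C_k}(1-z_i)\ge 1$ for all clauses $C_k$, together with $z_i\ge 0$ and $-z_i\ge -1$ for all $i$. A *Stabbing Planes (SP) refutation* of $F$ is a finite binary tree in which the two edges leaving each inner node are labelled with $Az\ge b$ and $Az\le b-1$ for some $A\in\mathbb Z^n$, $b\in\mathbb Z$, and each leaf is labelled with a non-negative linear combination of inequalities of $F$ and inequalities on the path from the root to that leaf that yields $0\ge 1$. Its *rank* is the length of a longest root-to-leaf path. For a partition $(X,Y)$ of the variables, $\mathsf{Search}_{X,Y}(F)\subseteq\{0,1\}^X\times\{0,1\}^Y\times[m]$ is the set of triples $(x,y,i)$ such that the total assignment $(x,y)$ falsifies $C_i$; Alice gets $x$, Bob gets $y$, and they have to output an $i$ with $(x,y,i)\in\mathsf{Search}_{X,Y}(F)$. A *real communication protocol* is a finite full binary tree whose leaves are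 labelled with outputs and in which at each inner node Alice and Bob send real numbers $a(x)$, $b(y)$ (depending on the node and on their own input) to a referee, and proceed to the left child if $a(x)\ge b(y)$ and to the right child otherwise; its cost is the depth of the tree. A *randomized protocol* is an ordinary two-party protocol tree in which each sent bit depends on the sender's input and private fair coin tosses; its cost is the maximal number of bits sent, and it has error $\varepsilon$ if on every input $(x,y)$ the output is wrong with probability at most $\varepsilon$. **Lemma.** There are an absolute constant $C$ and, for each $\varepsilon>0$, a constant $D_\varepsilon$ depending only on $\varepsilon$, such that the following holds. Let $n\ge 2$, let $F$ be an unsatisfiable CNF over $n$ variables, let $(X,Y)$ be any partition of the variables, and suppose that $F$ has an SP refutation of rank $r$. Then 1. there is a real communication protocol of cost at most $C\,(r+\log_2 n)$ that solves $\mathsf{Search}_{X,Y}(F)$; 2. for each $\varepsilon>0$ there is a randomized protocol of cost at most $D_\varepsilon\,(r\log_2 n+\log_2^2 n)$ that solves $\mathsf{Search}_{X,Y}(F)$ with error $\varepsilon$. -/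

import Mathlib

namespace StabbingPlanes

/-! ### Integer linear inequalities -/

/-- The integer linear inequality `A x ≥ b` in the variables `x₁, …, xₙ`,
with `A = coeff ∈ ℤⁿ` and `b = bound ∈ ℤ`. -/
structure LinIneq (n : ℕ) where
  coeff : Fin n → ℤ
  bound : ℤ

/-- The integer negation `A x ≤ b - 1` of `A x ≥ b`, written as `(-A) x ≥ 1 - b`. -/
def LinIneq.neg {n : ℕ} (L : LinIneq n) : LinIneq n where
  coeff := fun j => -L.coeff j
  bound := 1 - L.bound

/-! ### CNF formulas -/

/-- A literal: `(i, true)` is the variable `xᵢ`, `(i, false)` is its negation. -/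
abbrev Literal (n : ℕ) := Fin n × Bool

/-- A clause is a finite set of literals (their disjunction). -/
abbrev Clause (n : ℕ) := Finset (Literal n)

/-- A CNF formula `C₁ ∧ ⋯ ∧ Cₘ` over `n` variables. -/
abbrev CNF (n m : ℕ) := Fin m → Clause n

/-- The total assignment `z` falsifies the clause `C`: every literal of `C` is false under `z`. -/
def Clause.Falsified {n : ℕ} (C : Clause n) (z : Fin n → Bool) : Prop :=
  ∀ l ∈ C, z l.1 ≠ l.2

/-- Every assignment falsifies some clause. -/
def CNF.Unsatisfiable {n m : ℕ} (F : CNF n m) : Prop :=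
  ∀ z : Fin n → Bool, ∃ i, Clause.Falsified (F i) z

/-- The translation `∑_{xᵢ ∈ C} xᵢ + ∑_{¬xᵢ ∈ C} (1 - xᵢ) ≥ 1` of a clause, with the constants
collected on the right-hand side. -/
def Clause.toLinIneq {n : ℕ} (C : Clause n) : LinIneq n where
  coeff := fun j => (if (j, true) ∈ C then 1 else 0) - (if (j, false) ∈ C then 1 else 0)
  bound := 1 - ((C.filter fun l => l.2 = false).card : ℤ)

/-- The axiom `xᵢ ≥ 0`. -/
def lowerAxiom {n : ℕ} (i : Fin n) : LinIneq n where
  coeff := fun j => if j = i then 1 else 0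
  bound := 0

/-- The axiom `-xᵢ ≥ -1`. -/
def upperAxiom {n : ℕ} (i : Fin n) : LinIneq n where
  coeff := fun j => if j = i then -1 else 0
  bound := -1

/-- The system of linear inequalities defined by a CNF: the translations of all clauses, together
with `xᵢ ≥ 0` and `-xᵢ ≥ -1` for all variables. -/
def CNF.system {n m : ℕ} (F : CNF n m) : Set (LinIneq n) :=
  Set.range (fun k => Clause.toLinIneq (F k)) ∪ Set.range lowerAxiom ∪ Set.range upperAxiom

/-! ### Stabbing Planes refutations -/

/-- `c` is a non-negative linear combination of (finitely many) inequalities of the system `S`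
that yields `0 ≥ 1`. -/
structure IsZeroGeOne {n : ℕ} (S : Set (LinIneq n)) (c : LinIneq n →₀ ℝ) : Prop where
  nonneg : ∀ L, 0 ≤ c L
  support_subset : ∀ L ∈ c.support, L ∈ S
  coeff_eq : ∀ j : Fin n, (c.sum fun L w => w * (L.coeff j : ℝ)) = 0
  bound_eq : (c.sum fun L w => w * (L.bound : ℝ)) = 1

/-- A threshold decision tree. The node `node q left right`, where `q` is `A x ≥ b`, has its right
outgoing edge labelled with `A x ≥ b` and its left outgoing edge labelled with the integer negation
`A x ≤ b - 1`. Leaves are labelled with the coefficients of a linear combination of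
inequalities. -/
inductive ThresholdTree (n : ℕ) where
  | leaf (c : LinIneq n →₀ ℝ) : ThresholdTree n
  | node (q : LinIneq n) (left right : ThresholdTree n) : ThresholdTree n

/-- The tree is a Stabbing Planes refutation of the system `S`: each leaf is labelled with a
non-negative linear combination of inequalities of `S` and inequalities on the path from the root to
that leaf that yields `0 ≥ 1`. (Going down an edge adds its label to the available inequalities.) -/
def ThresholdTree.IsRefutation {n : ℕ} : ThresholdTree n → Set (LinIneq n) → Prop
  | .leaf c, S => IsZeroGeOne S c
  | .node q left right, S =>
      left.IsRefutation (insert q.neg S) ∧ right.IsRefutation (insert q S)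

/-- The rank: the number of edges of a longest path from the root to a leaf. -/
def ThresholdTree.rank {n : ℕ} : ThresholdTree n → ℕ
  | .leaf _ => 0
  | .node _ left right => max left.rank right.rank + 1

/-! ### The search problem -/

/-- `Search_{X,Y}(F) ⊆ {0,1}^X × {0,1}^Y × [m]`: the triples `(x, y, i)` such that the total
assignment `z = (x, y)` falsifies the clause `i`. When `(X, Y)` is a partition of the variables,
there is exactly one `z` that restricts to `x` and `y`. -/
def Search {n m : ℕ} (F : CNF n m) (X Y : Finset (Fin n)) :
    Set ((X → Bool) × (Y → Bool) × Fin m) :=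
  {t | ∃ z : Fin n → Bool, (∀ v : X, z v = t.1 v) ∧ (∀ v : Y, z v = t.2.1 v) ∧
    Clause.Falsified (F t.2.2) z}

/-! ### Real communication protocols -/

/-- A real communication protocol: at `node a b left right` the players send `a x` and `b y` to the
referee, and go to `left` if `a x ≥ b y` and to `right` otherwise. -/
inductive RealProtocol (𝒳 𝒴 𝒵 : Type) where
  | leaf (z : 𝒵) : RealProtocol 𝒳 𝒴 𝒵
  | node (a : 𝒳 → ℝ) (b : 𝒴 → ℝ) (left right : RealProtocol 𝒳 𝒴 𝒵) : RealProtocol 𝒳 𝒴 𝒵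

/-- The output of the protocol on the input `(x, y)`. -/
noncomputable def RealProtocol.output {𝒳 𝒴 𝒵 : Type} : RealProtocol 𝒳 𝒴 𝒵 → 𝒳 → 𝒴 → 𝒵
  | .leaf z, _, _ => z
  | .node a b left right, x, y => if a x ≥ b y then left.output x y else right.output x y

/-- The cost: the depth of the tree. -/
def RealProtocol.cost {𝒳 𝒴 𝒵 : Type} : RealProtocol 𝒳 𝒴 𝒵 → ℕ
  | .leaf _ => 0
  | .node _ _ left right => max left.cost right.cost + 1

/-- The protocol solves the search problem given by the relation `S`. -/
def RealProtocol.Solves {𝒳 𝒴 𝒵 : Type} (P : RealProtocol 𝒳 𝒴 𝒵) (S : Set (𝒳 × 𝒴 × 𝒵)) : Prop :=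
  ∀ x y, (x, y, P.output x y) ∈ S

/-! ### Deterministic and randomized communication protocols -/

/-- A two-party communication protocol tree: at each inner node one of the players sends a bit that
depends on her or his input. -/
inductive Protocol (𝒳 𝒴 𝒵 : Type) where
  | leaf (z : 𝒵) : Protocol 𝒳 𝒴 𝒵
  | alice (f : 𝒳 → Bool) (left right : Protocol 𝒳 𝒴 𝒵) : Protocol 𝒳 𝒴 𝒵
  | bob (g : 𝒴 → Bool) (left right : Protocol 𝒳 𝒴 𝒵) : Protocol 𝒳 𝒴 𝒵

/-- The output of the protocol on the input `(x, y)`. -/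
def Protocol.output {𝒳 𝒴 𝒵 : Type} : Protocol 𝒳 𝒴 𝒵 → 𝒳 → 𝒴 → 𝒵
  | .leaf z, _, _ => z
  | .alice f left right, x, y => if f x then right.output x y else left.output x y
  | .bob g left right, x, y => if g y then right.output x y else left.output x y

/-- The cost: the depth of the tree, which is the maximal number of bits sent. -/
def Protocol.cost {𝒳 𝒴 𝒵 : Type} : Protocol 𝒳 𝒴 𝒵 → ℕ
  | .leaf _ => 0
  | .alice _ left right => max left.cost right.cost + 1
  | .bob _ left right => max left.cost right.cost + 1

/-- A (private-coin) randomized protocol: Alice and Bob privately toss `aliceCoins` and `bobCoins`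
independent fair coins, and each sees the own input and the own coins. -/
structure RandomizedProtocol (𝒳 𝒴 𝒵 : Type) where
  aliceCoins : ℕ
  bobCoins : ℕ
  tree : Protocol (𝒳 × (Fin aliceCoins → Bool)) (𝒴 × (Fin bobCoins → Bool)) 𝒵

/-- The cost: the maximal number of bits sent, over all inputs and all outcomes of the coins. -/
def RandomizedProtocol.cost {𝒳 𝒴 𝒵 : Type} (Q : RandomizedProtocol 𝒳 𝒴 𝒵) : ℕ :=
  Q.tree.cost

open Classical in
/-- The probability, over the coins, that the output on `(x, y)` violates the relation `S`. -/
noncomputable def RandomizedProtocol.errorProb {𝒳 𝒴 𝒵 : Type} (Q : RandomizedProtocol 𝒳 𝒴 𝒵)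
    (S : Set (𝒳 × 𝒴 × 𝒵)) (x : 𝒳) (y : 𝒴) : ℝ :=
  ((Finset.univ.filter fun ρ : (Fin Q.aliceCoins → Bool) × (Fin Q.bobCoins → Bool) =>
      (x, y, Q.tree.output (x, ρ.1) (y, ρ.2)) ∉ S).card : ℝ) / 2 ^ (Q.aliceCoins + Q.bobCoins)

/-- On every input the protocol solves `S` with error probability at most `ε`. -/
def RandomizedProtocol.SolvesWithError {𝒳 𝒴 𝒵 : Type} (Q : RandomizedProtocol 𝒳 𝒴 𝒵)
    (S : Set (𝒳 × 𝒴 × 𝒵)) (ε : ℝ) : Prop :=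
  ∀ x y, Q.errorProb S x y ≤ ε

end StabbingPlanes

open StabbingPlanes

namespace StabbingPlanes

/-! ### Real protocols from threshold trees -/

/-! For a joint input `z = (x, y)` the value `A z - b` is a function of `x` plus a function of `y`,
so one real comparison decides a query, and the players can follow the refutation down to a leaf.
There the path inequalities and the axioms `0 ≤ zᵢ ≤ 1` hold at `z`, while the leaf's combination
makes the weighted sum of all slacks negative; hence some clause inequality in it is violated, and
its clause is falsified. Carathéodory leaves at most `n + 2` inequalities
(`IsZeroGeOne.exists_card_le`), and binary search over partial sums finds a violated one
(`RealProtocol.exists_neg_summand`).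

For the randomized bound, a real comparison depends only on ranks among Alice's inputs, hence on
numbers with `O(n)` bits, and binary search for the first difference uses `O(log n)` equality tests.
Making each test reliable separately would cost a further factor. Instead, tests err with
probability at most `1/16`, only by accepting, and a backtracking walk keeps rechecking the accepted
equalities. Its distance from a correct leaf drifts to zero (`exists_next_stack`), and the potential
`4 ^ distance` bounds the failure probability (`card_bad_walk_le`). Newman's sampling argument
(`exists_samples`) then replaces the shared hash functions by a short index tossed by Alice. -/

/-- The value `A z - b` of the inequality `A z ≥ b` at a Boolean assignment. -/
noncomputable def LinIneq.slack {n : ℕ} (L : LinIneq n) (z : Fin n → Bool) : ℝ :=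
  ∑ j, (L.coeff j : ℝ) * (if z j then 1 else 0) - L.bound

theorem LinIneq.slack_neg {n : ℕ} (L : LinIneq n) (z : Fin n → Bool) :
    L.neg.slack z = -1 - L.slack z := by
  simp only [LinIneq.slack, LinIneq.neg]
  push_cast
  simp only [neg_mul, Finset.sum_neg_distrib]
  ring

/-- Integrality: a negative slack at a Boolean point is at most `-1`. -/
theorem LinIneq.slack_neg_nonneg {n : ℕ} {L : LinIneq n} {z : Fin n → Bool}
    (h : L.slack z < 0) : 0 ≤ L.neg.slack z := by
  rw [L.slack_neg]
  have hint : L.slack z =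
      ((∑ j, L.coeff j * (if z j then 1 else 0) - L.bound : ℤ) : ℝ) := by
    simp only [LinIneq.slack]
    push_cast
    rfl
  rw [hint] at h ⊢
  have h' : (∑ j, L.coeff j * (if z j then 1 else 0) - L.bound : ℤ) < 0 := by exact_mod_cast h
  have : (∑ j, L.coeff j * (if z j then 1 else 0) - L.bound : ℤ) ≤ -1 := by omega
  have : ((∑ j, L.coeff j * (if z j then 1 else 0) - L.bound : ℤ) : ℝ) ≤ -1 := by exact_mod_cast this
  linarith

theorem slack_lowerAxiom_nonneg {n : ℕ} (i : Fin n) (z : Fin n → Bool) :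
    0 ≤ (lowerAxiom i).slack z := by
  simp only [LinIneq.slack, lowerAxiom, Int.cast_ite, Int.cast_one, Int.cast_zero, ite_mul,
    zero_mul, one_mul, Finset.sum_ite_eq', Finset.mem_univ, if_true]
  split_ifs <;> norm_num

theorem slack_upperAxiom_nonneg {n : ℕ} (i : Fin n) (z : Fin n → Bool) :
    0 ≤ (upperAxiom i).slack z := by
  simp only [LinIneq.slack, upperAxiom, Int.cast_ite, Int.cast_neg, Int.cast_one, Int.cast_zero,
    ite_mul, zero_mul, Finset.sum_ite_eq', Finset.mem_univ, if_true]
  split_ifs <;> norm_num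

/-- In this form every summand is non-negative, so a single true literal already makes the slack
non-negative. -/
theorem Clause.slack_toLinIneq {n : ℕ} (C : Clause n) (z : Fin n → Bool) :
    (Clause.toLinIneq C).slack z =
      ∑ j, ((if (j, true) ∈ C then (if z j then 1 else 0) else 0) +
        (if (j, false) ∈ C then (if z j then 0 else 1) else 0)) - 1 := by
  have hcard : (C.filter fun l => l.2 = false).card =
      ∑ j, if (j, false) ∈ C then 1 else 0 := by
    rw [← Finset.card_filter]
    refine Finset.card_bij' (fun l _ => l.1) (fun j _ => (j, false)) ?_ ?_ ?_ ?_
    · rintro ⟨j, b⟩ h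
      simp only [Finset.mem_filter] at h
      obtain ⟨h, rfl⟩ := h
      simpa using h
    · intro j h
      simpa using h
    · rintro ⟨j, b⟩ h
      simp only [Finset.mem_filter] at h
      simp [h.2]
    · intro j h
      rfl
  simp only [LinIneq.slack, Clause.toLinIneq, hcard]
  push_cast
  have : ∀ a b c : ℝ, a - (1 - b) = a + b - 1 := fun a b _ => by ring
  rw [this _ _ 0, ← Finset.sum_add_distrib]
  congr 1
  refine Finset.sum_congr rfl fun j _ => ?_
  split_ifs <;> simp

theorem Clause.falsified_of_slack_neg {n : ℕ} {C : Clause n} {z : Fin n → Bool}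
    (h : (Clause.toLinIneq C).slack z < 0) : C.Falsified z := by
  rintro ⟨j, b⟩ hl hz
  rw [Clause.slack_toLinIneq] at h
  have hle := Finset.single_le_sum (s := Finset.univ)
    (f := fun j => ((if (j, true) ∈ C then (if z j then 1 else 0) else 0) +
        (if (j, false) ∈ C then (if z j then 0 else 1) else 0) : ℝ))
    (fun j _ => by positivity) (Finset.mem_univ j)
  have h1 : (1 : ℝ) ≤ (if (j, true) ∈ C then (if z j then 1 else 0) else 0) +
        (if (j, false) ∈ C then (if z j then 0 else 1) else 0) := by
    dsimp only at hz hl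
    subst hz
    cases hb : z j <;> rw [hb] at hl <;> simp [hl]
  linarith

/-- Carathéodory's theorem for derivations of `0 ≥ 1`: at most `n + 2` inequalities suffice. -/
theorem IsZeroGeOne.exists_card_le {n : ℕ} {S : Set (LinIneq n)} {c : LinIneq n →₀ ℝ}
    (hc : IsZeroGeOne S c) : ∃ (ι : Type) (_ : Fintype ι) (L : ι → LinIneq n) (w : ι → ℝ),
      Fintype.card ι ≤ n + 2 ∧ (∀ i, L i ∈ S) ∧ (∀ i, 0 ≤ w i) ∧
      (∀ j, ∑ i, w i * ((L i).coeff j : ℝ) = 0) ∧ 0 < ∑ i, w i * ((L i).bound : ℝ) := by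
  classical
  let v : LinIneq n → (Fin n → ℝ) × ℝ := fun L => (fun j => (L.coeff j : ℝ), (L.bound : ℝ))
  -- The bound `1` cannot come from zero weights; positivity of the total weight permits
  -- normalization to a convex combination.
  have hpos : 0 < ∑ L ∈ c.support, c L := by
    have h0 : 0 ≤ ∑ L ∈ c.support, c L := Finset.sum_nonneg fun L _ => hc.nonneg L
    refine lt_of_le_of_ne h0 fun h => ?_
    have hz := (Finset.sum_eq_zero_iff_of_nonneg fun L _ => hc.nonneg L).1 h.symm
    have := hc.bound_eq
    rw [Finsupp.sum, Finset.sum_eq_zero fun L hL => by rw [hz L hL, zero_mul]] at this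
    exact zero_ne_one this
  -- Carathéodory is applied to the vectors `(A, b)` in dimension `n + 1`. Normalization rescales
  -- the bound `1`, so only its positivity survives.
  have hmem := Finset.centerMass_mem_convexHull (R := ℝ) (s := v '' S) c.support
    (w := c) (z := v) (fun L _ => hc.nonneg L) hpos
    (fun L hL => Set.mem_image_of_mem v (hc.support_subset L hL))
  obtain ⟨ι, hι, p, w, hp, hind, hw, hw1, hsum⟩ := eq_pos_convex_span_of_mem_convexHull hmem
  choose L hLS hLv using fun i => hp (Set.mem_range_self i)
  have hcomb : ∑ i, w i • v (L i) = (∑ L ∈ c.support, c L)⁻¹ • ∑ L ∈ c.support, c L • v L := by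
    simpa only [hLv, Finset.centerMass] using hsum
  refine ⟨ι, hι, L, w, ?_, hLS, fun i => (hw i).le, fun j => ?_, ?_⟩
  · refine hind.card_le_finrank_succ.trans ?_
    have := (vectorSpan ℝ (Set.range p)).finrank_le
    rw [Module.finrank_prod] at this
    simp at this
    omega
  · have h := congrArg (fun q => q.1 j) hcomb
    simp only [Prod.fst_sum, Prod.smul_fst, Finset.sum_apply, Pi.smul_apply, smul_eq_mul, v] at h
    have h0 := hc.coeff_eq j
    rw [Finsupp.sum] at h0
    rw [h, h0, mul_zero]
  · have h := congrArg Prod.snd hcomb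
    simp only [Prod.snd_sum, Prod.smul_snd, smul_eq_mul, v] at h
    have h0 := hc.bound_eq
    rw [Finsupp.sum] at h0
    rw [h, h0, mul_one]
    positivity

theorem sum_mul_slack_neg {n : ℕ} {ι : Type} [Fintype ι] {L : ι → LinIneq n} {w : ι → ℝ}
    (hcoeff : ∀ j, ∑ i, w i * ((L i).coeff j : ℝ) = 0)
    (hbound : 0 < ∑ i, w i * ((L i).bound : ℝ)) (z : Fin n → Bool) :
    ∑ i, w i * (L i).slack z < 0 := by
  have : ∑ i, w i * (L i).slack z =
      ∑ j, (∑ i, w i * ((L i).coeff j : ℝ)) * (if z j then 1 else 0) -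
        ∑ i, w i * ((L i).bound : ℝ) := by
    simp only [LinIneq.slack, mul_sub, Finset.sum_sub_distrib, Finset.mul_sum, Finset.sum_mul]
    rw [Finset.sum_comm]
    simp only [mul_assoc]
  rw [this]
  simpa [hcoeff] using hbound

/-- Binary search for a negative summand of a negative sum of separable terms. -/
theorem RealProtocol.exists_neg_summand {𝒳 𝒴 𝒵 ι : Type} [Inhabited 𝒵] (d : ι → 𝒵)
    (f : ι → 𝒳 → ℝ) (g : ι → 𝒴 → ℝ) (k : ℕ) (l : List ι) (hl : l.length ≤ 2 ^ k) :
    ∃ P : RealProtocol 𝒳 𝒴 𝒵, P.cost ≤ k ∧ ∀ x y, (l.map fun i => f i x + g i y).sum < 0 →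
      ∃ i, P.output x y = d i ∧ f i x + g i y < 0 := by
  induction k generalizing l with
  | zero =>
    match l, hl with
    | [], _ => exact ⟨.leaf default, le_rfl, fun x y h => by simp at h⟩
    | [i], _ => exact ⟨.leaf (d i), le_rfl, fun x y h => ⟨i, rfl, by simpa using h⟩⟩
    | _ :: _ :: _, hl => simp at hl
  | succ k ih =>
    rw [pow_succ] at hl
    obtain ⟨P₁, hP₁, h₁⟩ := ih (l.take (2 ^ k)) (by simp)
    obtain ⟨P₂, hP₂, h₂⟩ := ih (l.drop (2 ^ k)) (by simp; omega)
    -- The comparison tells whether the first half has a non-negative sum; if so, the second half is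
    -- negative, hence `P₂` on the left.
    refine ⟨.node (fun x => ((l.take (2 ^ k)).map fun i => f i x).sum)
      (fun y => -((l.take (2 ^ k)).map fun i => g i y).sum) P₂ P₁, ?_, fun x y h => ?_⟩
    · simp only [RealProtocol.cost]
      omega
    · have hsplit : (l.map fun i => f i x + g i y).sum =
          ((l.take (2 ^ k)).map fun i => f i x + g i y).sum +
          ((l.drop (2 ^ k)).map fun i => f i x + g i y).sum := by
        rw [← List.sum_append, ← List.map_append, List.take_append_drop]
      have hadd : ((l.take (2 ^ k)).map fun i => f i x + g i y).sum =
          ((l.take (2 ^ k)).map fun i => f i x).sum + ((l.take (2 ^ k)).map fun i => g i y).sum :=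
        List.sum_map_add
      simp only [RealProtocol.output]
      split_ifs with hc
      · exact h₂ x y (by linarith)
      · exact h₁ x y (by linarith)

/-- The total assignment given by the players' inputs. -/
def joinInputs {n : ℕ} {X Y : Finset (Fin n)} (h : IsCompl X Y) (x : X → Bool) (y : Y → Bool) :
    Fin n → Bool := fun v =>
  if hv : v ∈ X then x ⟨v, hv⟩ else y ⟨v, by
    have := Finset.mem_univ v
    rw [← Finset.top_eq_univ, ← h.sup_eq_top, Finset.sup_eq_union, Finset.mem_union] at this
    exact this.resolve_left hv⟩

theorem mem_search_of_falsified {n m : ℕ} {F : CNF n m} {X Y : Finset (Fin n)}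
    (h : IsCompl X Y) {x : X → Bool} {y : Y → Bool} {i : Fin m}
    (hi : (F i).Falsified (joinInputs h x y)) : (x, y, i) ∈ Search F X Y := by
  refine ⟨joinInputs h x y, fun v => ?_, fun v => ?_, hi⟩
  · simp [joinInputs]
  · have : (v : Fin n) ∉ X := fun hv => Finset.disjoint_left.1 h.disjoint hv v.2
    simp [joinInputs, this]

theorem LinIneq.exists_slack_eq_add {n : ℕ} {X Y : Finset (Fin n)} (h : IsCompl X Y)
    (L : LinIneq n) : ∃ (f : (X → Bool) → ℝ) (g : (Y → Bool) → ℝ),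
      ∀ x y, L.slack (joinInputs h x y) = f x + g y := by
  refine ⟨fun x => ∑ v, if hv : v ∈ X then (L.coeff v : ℝ) * (if x ⟨v, hv⟩ then 1 else 0) else 0,
    fun y => ∑ v, (if hv : v ∈ Y then (L.coeff v : ℝ) * (if y ⟨v, hv⟩ then 1 else 0) else 0) -
      L.bound, fun x y => ?_⟩
  rw [LinIneq.slack, add_sub, ← Finset.sum_add_distrib]
  congr 1
  refine Finset.sum_congr rfl fun v _ => ?_
  by_cases hv : v ∈ X
  · have : v ∉ Y := Finset.disjoint_left.1 h.disjoint hv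
    simp [joinInputs, hv, this]
  · have hY : v ∈ Y := by
      have := Finset.mem_univ v
      rw [← Finset.top_eq_univ, ← h.sup_eq_top, Finset.sup_eq_union, Finset.mem_union] at this
      exact this.resolve_left hv
    simp [joinInputs, hv, hY]

/-- Invariant of the descent: every available inequality that is not a clause translation holds at
the input. Clause translations are exempt, since a violated one is what the players look for. -/
theorem ThresholdTree.exists_realProtocol {n m : ℕ} [Inhabited (Fin m)] (F : CNF n m)
    {X Y : Finset (Fin n)} (h : IsCompl X Y) (T : ThresholdTree n) (S : Set (LinIneq n))
    (hT : T.IsRefutation S) :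
    ∃ P : RealProtocol (X → Bool) (Y → Bool) (Fin m), P.cost ≤ T.rank + Nat.clog 2 (n + 2) ∧
      ∀ x y, (∀ L ∈ S, L ∉ Set.range (fun k => Clause.toLinIneq (F k)) →
        0 ≤ L.slack (joinInputs h x y)) → (x, y, P.output x y) ∈ Search F X Y := by
  classical
  induction T generalizing S with
  | leaf c =>
    obtain ⟨ι, hι, L, w, hcard, hLS, hw, hcoeff, hbound⟩ := IsZeroGeOne.exists_card_le hT
    choose f g hfg using fun i => (L i).exists_slack_eq_add h
    let R : Set (LinIneq n) := Set.range (fun k => Clause.toLinIneq (F k))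
    let d : ι → Fin m := fun i => if hi : L i ∈ R then hi.choose else default
    -- Summands of non-clause inequalities are replaced by zero. They were non-negative, so the sum
    -- stays negative, and a zero summand is never the one found.
    obtain ⟨P, hP, hout⟩ := RealProtocol.exists_neg_summand d
      (fun i x => if L i ∈ R then w i * f i x else 0) (fun i y => if L i ∈ R then w i * g i y else 0)
      (Nat.clog 2 (n + 2)) Finset.univ.toList (by
        rw [Finset.length_toList, Finset.card_univ]
        exact hcard.trans (Nat.le_pow_clog one_lt_two _))
    refine ⟨P, by simpa [ThresholdTree.rank] using hP, fun x y hS => ?_⟩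
    obtain ⟨i, hi, hneg⟩ := hout x y (by
      rw [Finset.sum_map_toList]
      refine lt_of_le_of_lt (Finset.sum_le_sum fun i _ => ?_)
        (sum_mul_slack_neg hcoeff hbound (joinInputs h x y))
      by_cases hR : L i ∈ R
      · simp [hR, hfg, mul_add]
      · simpa [hR] using mul_nonneg (hw i) (hS _ (hLS i) hR))
    by_cases hR : L i ∈ R
    · refine mem_search_of_falsified h (Clause.falsified_of_slack_neg ?_)
      rw [hi]
      simp only [hR, if_true, ← mul_add, ← hfg] at hneg
      have hd : Clause.toLinIneq (F (d i)) = L i := by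
        simp only [d, hR, dif_pos]
        exact hR.choose_spec
      rw [hd]
      exact neg_of_mul_neg_right hneg (hw i)
    · simp [hR] at hneg
  | node q left right ihl ihr =>
    obtain ⟨P₁, hP₁, h₁⟩ := ihl _ hT.1
    obtain ⟨P₂, hP₂, h₂⟩ := ihr _ hT.2
    obtain ⟨f, g, hfg⟩ := q.exists_slack_eq_add h
    refine ⟨.node f (fun y => -g y) P₂ P₁, ?_, fun x y hS => ?_⟩
    · simp only [RealProtocol.cost, ThresholdTree.rank]
      omega
    · simp only [RealProtocol.output]
      split_ifs with hc
      · refine h₂ x y fun L hL hR => ?_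
        rcases hL with rfl | hL
        · rw [hfg]
          linarith
        · exact hS L hL hR
      · refine h₁ x y fun L hL hR => ?_
        rcases hL with rfl | hL
        · refine LinIneq.slack_neg_nonneg ?_
          rw [hfg]
          linarith
        · exact hS L hL hR

theorem exists_realProtocol_of_isRefutation {n m : ℕ} {F : CNF n m} (hF : F.Unsatisfiable)
    {X Y : Finset (Fin n)} (h : IsCompl X Y) {T : ThresholdTree n}
    (hT : T.IsRefutation F.system) :
    ∃ P : RealProtocol (X → Bool) (Y → Bool) (Fin m), P.Solves (Search F X Y) ∧
      P.cost ≤ T.rank + Nat.clog 2 (n + 2) := by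
  have : Inhabited (Fin m) := ⟨(hF fun _ => true).choose⟩
  obtain ⟨P, hP, hout⟩ := T.exists_realProtocol F h F.system hT
  refine ⟨P, fun x y => hout x y fun L hL hR => ?_, hP⟩
  rcases hL with (hL | ⟨i, rfl⟩) | ⟨i, rfl⟩
  · exact absurd hL hR
  · exact slack_lowerAxiom_nonneg i _
  · exact slack_upperAxiom_nonneg i _

/-! ### Decision trees with an equality oracle -/

/-- A protocol with an equality oracle: `node a b left right` branches on whether `a x = b y`,
going to `right` if the two numbers are equal. -/
inductive EqProtocol (𝒳 𝒴 𝒵 : Type) where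
  | leaf (z : 𝒵) : EqProtocol 𝒳 𝒴 𝒵
  | node (a : 𝒳 → ℕ) (b : 𝒴 → ℕ) (left right : EqProtocol 𝒳 𝒴 𝒵) : EqProtocol 𝒳 𝒴 𝒵

/-- The output on the input `(x, y)`. -/
def EqProtocol.output {𝒳 𝒴 𝒵 : Type} : EqProtocol 𝒳 𝒴 𝒵 → 𝒳 → 𝒴 → 𝒵
  | .leaf z, _, _ => z
  | .node a b left right, x, y => if a x = b y then right.output x y else left.output x y

/-- The depth of the tree. -/
def EqProtocol.depth {𝒳 𝒴 𝒵 : Type} : EqProtocol 𝒳 𝒴 𝒵 → ℕ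
  | .leaf _ => 0
  | .node _ _ left right => max left.depth right.depth + 1

/-- The label of the leftmost leaf. -/
def EqProtocol.leftmost {𝒳 𝒴 𝒵 : Type} : EqProtocol 𝒳 𝒴 𝒵 → 𝒵
  | .leaf z => z
  | .node _ _ left _ => left.leftmost

/-- Comparison of two `2 ^ k`-bit numbers with `k + 1` equality queries. -/
theorem EqProtocol.exists_compare {𝒳 𝒴 𝒵 : Type} (E₁ E₂ : EqProtocol 𝒳 𝒴 𝒵) (k : ℕ)
    (a : 𝒳 → ℕ) (b : 𝒴 → ℕ) (ha : ∀ x, a x < 2 ^ 2 ^ k) (hb : ∀ y, b y < 2 ^ 2 ^ k) :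
    ∃ E : EqProtocol 𝒳 𝒴 𝒵, E.depth ≤ max E₁.depth E₂.depth + (k + 1) ∧
      ∀ x y, E.output x y = if b y ≤ a x then E₁.output x y else E₂.output x y := by
  induction k generalizing a b with
  | zero =>
    -- For single bits, `a < b` means `a = 0` and `b = 1`, that is, `a + 1 = b`.
    refine ⟨.node (fun x => a x + 1) b E₁ E₂, le_rfl, fun x y => ?_⟩
    have := ha x
    have := hb y
    simp only [EqProtocol.output]
    by_cases h : a x + 1 = b y
    · rw [if_pos h, if_neg (by omega)]
    · rw [if_neg h, if_pos (by omega)]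
  | succ k ih =>
    set M := 2 ^ 2 ^ k with hM
    have hMpos : 0 < M := by positivity
    have hsq : 2 ^ 2 ^ (k + 1) = M * M := by rw [hM, ← pow_add, pow_succ, mul_two]
    rw [hsq] at ha hb
    obtain ⟨P₁, hP₁, h₁⟩ := ih (fun x => a x / M) (fun y => b y / M)
      (fun x => Nat.div_lt_of_lt_mul (ha x)) (fun y => Nat.div_lt_of_lt_mul (hb y))
    obtain ⟨P₂, hP₂, h₂⟩ := ih (fun x => a x % M) (fun y => b y % M)
      (fun x => Nat.mod_lt _ hMpos) (fun y => Nat.mod_lt _ hMpos)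
    -- If the upper halves agree, the lower halves decide; otherwise the upper halves do.
    refine ⟨.node (fun x => a x / M) (fun y => b y / M) P₁ P₂, ?_, fun x y => ?_⟩
    · simp only [EqProtocol.depth]
      omega
    · simp only [EqProtocol.output, h₁, h₂]
      have hx := Nat.div_add_mod (a x) M
      have hy := Nat.div_add_mod (b y) M
      have hxm := Nat.mod_lt (a x) hMpos
      have hym := Nat.mod_lt (b y) hMpos
      split_ifs with h3 h4 h5 h5 h6 h7 h7
      · rfl
      · rw [h3] at hx
        omega
      · rw [h3] at hx
        omega
      · rfl
      · rfl
      · exact absurd (lt_of_le_of_ne h6 fun h => h3 h.symm) fun hlt => by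
          have := Nat.mul_le_mul_left M (Nat.succ_le_of_lt hlt)
          rw [Nat.mul_succ] at this
          omega
      · exact absurd (Nat.div_le_div_right h7) h6
      · rfl

/-- A comparison of reals depends on ranks only. -/
theorem exists_rank {𝒳 𝒴 : Type} [Fintype 𝒳] (a : 𝒳 → ℝ) (b : 𝒴 → ℝ) :
    ∃ (α : 𝒳 → ℕ) (β : 𝒴 → ℕ), (∀ x, α x ≤ Fintype.card 𝒳) ∧ (∀ y, β y ≤ Fintype.card 𝒳) ∧
      ∀ x y, β y ≤ α x ↔ a x ≥ b y := by
  classical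
  -- Both players count the values of `a` below their own number. If `a x < b y`, then `x` itself is
  -- counted only by Bob.
  refine ⟨fun x => (Finset.univ.filter fun x' => a x' < a x).card,
    fun y => (Finset.univ.filter fun x' => a x' < b y).card,
    fun x => Finset.card_le_univ _, fun y => Finset.card_le_univ _, fun x y => ⟨fun h => ?_, fun h => ?_⟩⟩
  · by_contra hlt
    rw [ge_iff_le, not_le] at hlt
    refine absurd h (not_le.2 (Finset.card_lt_card ?_))
    rw [Finset.ssubset_iff_of_subset]
    · exact ⟨x, by simpa using hlt, by simp⟩
    · intro x' hx'
      simp only [Finset.mem_filter, Finset.mem_univ, true_and] at hx' ⊢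
      exact hx'.trans hlt
  · refine Finset.card_le_card fun x' hx' => ?_
    simp only [Finset.mem_filter, Finset.mem_univ, true_and] at hx' ⊢
    exact hx'.trans_le h

theorem RealProtocol.exists_eqProtocol {𝒳 𝒴 𝒵 : Type} [Fintype 𝒳] (k : ℕ)
    (hk : Fintype.card 𝒳 < 2 ^ 2 ^ k) (P : RealProtocol 𝒳 𝒴 𝒵) :
    ∃ E : EqProtocol 𝒳 𝒴 𝒵, E.depth ≤ P.cost * (k + 1) ∧
      ∀ x y, E.output x y = P.output x y := by
  induction P with
  | leaf z => exact ⟨.leaf z, Nat.zero_le _, fun _ _ => rfl⟩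
  | node a b left right ihl ihr =>
    obtain ⟨E₁, hE₁, h₁⟩ := ihl
    obtain ⟨E₂, hE₂, h₂⟩ := ihr
    obtain ⟨α, β, hα, hβ, hαβ⟩ := exists_rank a b
    obtain ⟨E, hE, hout⟩ := EqProtocol.exists_compare E₁ E₂ k α β
      (fun x => (hα x).trans_lt hk) (fun y => (hβ y).trans_lt hk)
    refine ⟨E, hE.trans ?_, fun x y => ?_⟩
    · simp only [RealProtocol.cost, add_mul, one_mul]
      have h3 := hE₁.trans (Nat.mul_le_mul_right (k + 1) (le_max_left left.cost right.cost))
      have h4 := hE₂.trans (Nat.mul_le_mul_right (k + 1) (le_max_right left.cost right.cost))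
      omega
    · rw [hout, RealProtocol.output]
      simp only [hαβ, h₁, h₂]


/-! ### Simulating an equality oracle by random hashing -/

/-- The players compare the bits `f x i` and `g y i` for `i ∈ l`, until the first difference. -/
def Protocol.compareBits {𝒳 𝒴 𝒵 ι : Type} (f : 𝒳 → ι → Bool) (g : 𝒴 → ι → Bool)
    (P Q : Protocol 𝒳 𝒴 𝒵) : List ι → Protocol 𝒳 𝒴 𝒵
  | [] => Q
  | i :: l => .alice (fun x => f x i)
      (.bob (fun y => g y i) (compareBits f g P Q l) P)
      (.bob (fun y => g y i) P (compareBits f g P Q l))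

theorem Protocol.cost_compareBits {𝒳 𝒴 𝒵 ι : Type} (f : 𝒳 → ι → Bool) (g : 𝒴 → ι → Bool)
    (P Q : Protocol 𝒳 𝒴 𝒵) (l : List ι) :
    (compareBits f g P Q l).cost ≤ max P.cost Q.cost + 2 * l.length := by
  induction l with
  | nil => simp [compareBits]
  | cons i l ih =>
    simp only [compareBits, Protocol.cost, List.length_cons]
    omega

open Classical in
theorem Protocol.output_compareBits {𝒳 𝒴 𝒵 ι : Type} (f : 𝒳 → ι → Bool) (g : 𝒴 → ι → Bool)
    (P Q : Protocol 𝒳 𝒴 𝒵) (l : List ι) (x : 𝒳) (y : 𝒴) :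
    (compareBits f g P Q l).output x y =
      if ∀ i ∈ l, f x i = g y i then Q.output x y else P.output x y := by
  induction l with
  | nil => simp [compareBits]
  | cons i l ih =>
    simp only [compareBits, Protocol.output, List.forall_mem_cons, ih]
    cases f x i <;> cases g y i <;> simp

/-- A hash function with four-bit values for subsets of `𝒳`. -/
abbrev Hash (𝒳 : Type) := Set 𝒳 → Fin 4 → Bool

/-- The players compare the hash values of the sets `{x' | a x' = a x}` and `{x' | a x' = b y}`,
which are equal if and only if `a x = b y`. -/
def Protocol.hashTest {𝒳 𝒴 𝒵 M : Type} (h : Hash 𝒳) (a : 𝒳 → M) (b : 𝒴 → M)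
    (P Q : Protocol 𝒳 𝒴 𝒵) : Protocol 𝒳 𝒴 𝒵 :=
  compareBits (fun x => h {x' | a x' = a x}) (fun y => h {x' | a x' = b y}) P Q (List.finRange 4)

theorem Protocol.cost_hashTest {𝒳 𝒴 𝒵 M : Type} (h : Hash 𝒳) (a : 𝒳 → M) (b : 𝒴 → M)
    (P Q : Protocol 𝒳 𝒴 𝒵) : (hashTest h a b P Q).cost ≤ max P.cost Q.cost + 8 := by
  simpa [hashTest] using Protocol.cost_compareBits (fun x => h {x' | a x' = a x})
    (fun y => h {x' | a x' = b y}) P Q (List.finRange 4)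

theorem Protocol.output_hashTest {𝒳 𝒴 𝒵 M : Type} (h : Hash 𝒳) (a : 𝒳 → M) (b : 𝒴 → M)
    (P Q : Protocol 𝒳 𝒴 𝒵) (x : 𝒳) (y : 𝒴) :
    (hashTest h a b P Q).output x y =
      if h {x' | a x' = a x} = h {x' | a x' = b y} then Q.output x y else P.output x y := by
  simp [hashTest, Protocol.output_compareBits, funext_iff]

/-- The point `x` lies only in the first set. Hashing such sets instead of the values keeps the hash
domain finite for finite `𝒳`, whatever the type of the values. -/
theorem setOf_eq_ne {𝒳 M : Type} {a : 𝒳 → M} {x : 𝒳} {c : M} (h : a x ≠ c) :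
    {x' | a x' = a x} ≠ {x' | a x' = c} := fun he =>
  h ((Set.ext_iff.1 he x).1 rfl)

open Classical in
/-- Two different points collide under a random function with probability `1 / |V|`. -/
theorem card_collisions {U V : Type} [Fintype U] [Fintype V] {u v : U} (h : u ≠ v) :
    Fintype.card V * (Finset.univ.filter fun f : U → V => f u = f v).card =
      Fintype.card (U → V) := by
  have hcard : (Finset.univ.filter fun f : U → V => f u = f v).card =
      Fintype.card ({w // w ≠ u} → V) := by
    rw [← Fintype.card_subtype]
    -- A colliding function is determined by its restriction to the points other than `u`.
    refine Fintype.card_congr ⟨fun f w => f.1 w,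
      fun f => ⟨fun w => if hw : w = u then f ⟨v, h.symm⟩ else f ⟨w, hw⟩, by simp [h.symm]⟩,
      fun f => ?_, fun f => ?_⟩
    · ext w
      by_cases hw : w = u
      · subst hw
        simp [f.2]
      · simp [hw]
    · ext w
      simp [w.2]
  rw [hcard, ← Fintype.card_prod]
  exact Fintype.card_congr (Equiv.funSplitAt u V).symm

/-- A position in an equality-oracle protocol, with the conjunction of the equalities that have
been accepted on the way to it. -/
structure Frame (𝒳 𝒴 𝒵 : Type) where
  tree : EqProtocol 𝒳 𝒴 𝒵
  left : 𝒳 → List ℕ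
  right : 𝒴 → List ℕ

/-- All accepted equalities hold on the input. -/
def Frame.Good {𝒳 𝒴 𝒵 : Type} (fr : Frame 𝒳 𝒴 𝒵) (x : 𝒳) (y : 𝒴) : Prop :=
  fr.left x = fr.right y

/-- The backtracking simulation of an equality-oracle protocol, with one hash function per step.
The stack holds the current position and its ancestors. A step first tests the accepted equalities
again, returning to the parent if they are refuted, and otherwise makes the next query. -/
def Protocol.walk {𝒳 𝒴 𝒵 : Type} (z₀ : 𝒵) : List (Hash 𝒳) → List (Frame 𝒳 𝒴 𝒵) → Protocol 𝒳 𝒴 𝒵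
  | _, [] => .leaf z₀
  -- At a leaf this is its label; at an inner node the output is arbitrary.
  | [], fr :: _ => .leaf fr.tree.leftmost
  | h :: hs, fr :: S => hashTest h fr.left fr.right (walk z₀ hs S)
      (match fr.tree with
        -- Waiting at a leaf lets later steps detect a falsely accepted equality.
        | .leaf _ => walk z₀ hs (fr :: S)
        | .node a b l r => hashTest h a b (walk z₀ hs (⟨l, fr.left, fr.right⟩ :: fr :: S))
            (walk z₀ hs (⟨r, fun x => a x :: fr.left x, fun y => b y :: fr.right y⟩ :: fr :: S)))

theorem Protocol.cost_walk {𝒳 𝒴 𝒵 : Type} (z₀ : 𝒵) (hs : List (Hash 𝒳))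
    (S : List (Frame 𝒳 𝒴 𝒵)) : (walk z₀ hs S).cost ≤ 16 * hs.length := by
  induction hs generalizing S with
  | nil => cases S <;> simp [walk, Protocol.cost]
  | cons h hs ih =>
    match S with
    | [] => simp [walk, Protocol.cost]
    | ⟨.leaf z, A, B⟩ :: S =>
      rw [walk]
      refine (Protocol.cost_hashTest _ _ _ _ _).trans ?_
      have h1 := ih S
      have h2 := ih (⟨.leaf z, A, B⟩ :: S)
      simp only [List.length_cons]
      omega
    | ⟨.node a b l r, A, B⟩ :: S =>
      rw [walk]
      refine (Protocol.cost_hashTest _ _ _ _ _).trans ?_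
      have h1 := ih S
      have h2 := ih (⟨l, A, B⟩ :: ⟨.node a b l r, A, B⟩ :: S)
      have h3 := ih (⟨r, fun x => a x :: A x, fun y => b y :: B y⟩ :: ⟨.node a b l r, A, B⟩ :: S)
      have h4 := Protocol.cost_hashTest h a b
        (walk z₀ hs (⟨l, A, B⟩ :: ⟨.node a b l r, A, B⟩ :: S))
        (walk z₀ hs
          (⟨r, fun x => a x :: A x, fun y => b y :: B y⟩ :: ⟨.node a b l r, A, B⟩ :: S))
      simp only [List.length_cons]
      omega

open Classical in
/-- The number of steps that are missing: to leave all bad frames, and to go down from the topmost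
good frame to a leaf. -/
noncomputable def remainingSteps {𝒳 𝒴 𝒵 : Type} (x : 𝒳) (y : 𝒴) : List (Frame 𝒳 𝒴 𝒵) → ℕ
  | [] => 0
  | fr :: S => if fr.Good x y then fr.tree.depth else remainingSteps x y S + 1

/-- The stack has a good frame, and all its good frames lead to an output in `W`. -/
structure SoundStack {𝒳 𝒴 𝒵 : Type} (x : 𝒳) (y : 𝒴) (W : Set 𝒵) (S : List (Frame 𝒳 𝒴 𝒵)) :
    Prop where
  output_mem : ∀ fr ∈ S, fr.Good x y → fr.tree.output x y ∈ W
  exists_good : ∃ fr ∈ S, fr.Good x y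

theorem SoundStack.cons {𝒳 𝒴 𝒵 : Type} {x : 𝒳} {y : 𝒴} {W : Set 𝒵} {S : List (Frame 𝒳 𝒴 𝒵)}
    (h : SoundStack x y W S) {fr : Frame 𝒳 𝒴 𝒵} (hfr : fr.Good x y → fr.tree.output x y ∈ W) :
    SoundStack x y W (fr :: S) :=
  ⟨List.forall_mem_cons.2 ⟨hfr, h.output_mem⟩,
    let ⟨fr', h1, h2⟩ := h.exists_good
    ⟨fr', List.mem_cons_of_mem _ h1, h2⟩⟩

theorem SoundStack.tail {𝒳 𝒴 𝒵 : Type} {x : 𝒳} {y : 𝒴} {W : Set 𝒵} {S : List (Frame 𝒳 𝒴 𝒵)}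
    {fr : Frame 𝒳 𝒴 𝒵} (h : SoundStack x y W (fr :: S)) (hfr : ¬fr.Good x y) :
    SoundStack x y W S := by
  refine ⟨fun fr' h' => h.output_mem fr' (List.mem_cons_of_mem _ h'), ?_⟩
  obtain ⟨fr', h1, h2⟩ := h.exists_good
  rcases List.mem_cons.1 h1 with rfl | h1
  · exact absurd h2 hfr
  · exact ⟨fr', h1, h2⟩

/-- The top frame is then a good leaf, and the walk never leaves it: true equalities pass every hash
test. -/
theorem output_walk_of_remainingSteps_eq_zero {𝒳 𝒴 𝒵 : Type} (z₀ : 𝒵) {x : 𝒳} {y : 𝒴} {W : Set 𝒵}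
    {S : List (Frame 𝒳 𝒴 𝒵)} (hS : SoundStack x y W S) (h0 : remainingSteps x y S = 0)
    (hs : List (Hash 𝒳)) : (Protocol.walk z₀ hs S).output x y ∈ W := by
  match S, hS with
  | [], hS => simpa using hS.exists_good
  | ⟨.node a b l r, A, B⟩ :: S, hS =>
    simp only [remainingSteps, EqProtocol.depth] at h0
    split_ifs at h0
  | ⟨.leaf z, A, B⟩ :: S, hS =>
    by_cases hg : Frame.Good (⟨.leaf z, A, B⟩ : Frame 𝒳 𝒴 𝒵) x y
    · induction hs with
      | nil => exact hS.output_mem _ List.mem_cons_self hg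
      | cons h hs ih =>
        rw [Protocol.walk, Protocol.output_hashTest, if_pos]
        · exact ih
        · dsimp only
          rw [show A x = B y from hg]
    · simp [remainingSteps, hg] at h0

open Classical in
/-- With probability `15 / 16` a step of the walk decreases the number of missing steps, and
otherwise it increases this number by at most one. -/
theorem exists_next_stack {𝒳 𝒴 𝒵 : Type} [Fintype 𝒳] (z₀ : 𝒵) {x : 𝒳} {y : 𝒴} {W : Set 𝒵}
    {S : List (Frame 𝒳 𝒴 𝒵)} (hS : SoundStack x y W S) {p : ℕ} (hp : remainingSteps x y S ≤ p + 1)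
    (hp0 : remainingSteps x y S ≠ 0) :
    ∃ bad : Finset (Hash 𝒳), 16 * bad.card ≤ Fintype.card (Hash 𝒳) ∧
      ∀ h, ∃ S', SoundStack x y W S' ∧
        remainingSteps x y S' ≤ (if h ∈ bad then p + 2 else p) ∧
        ∀ hs, (Protocol.walk z₀ (h :: hs) S).output x y = (Protocol.walk z₀ hs S').output x y := by
  -- Only one test per step is critical: the new query in a good frame, the recheck in a bad one. So
  -- one collision event suffices, although both tests share the hash function.
  have hcoll : ∀ {M : Type} (a : 𝒳 → M) (b : 𝒴 → M), a x ≠ b y →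
      16 * (Finset.univ.filter fun h : Hash 𝒳 =>
        h {x' | a x' = a x} = h {x' | a x' = b y}).card ≤ Fintype.card (Hash 𝒳) := by
    intro M a b hab
    have := card_collisions (V := Fin 4 → Bool) (setOf_eq_ne hab)
    rw [show Fintype.card (Fin 4 → Bool) = 16 by simp] at this
    refine le_of_eq ?_
    convert this
  match S, hS with
  | [], hS => simpa using hS.exists_good
  | fr :: S, hS =>
    by_cases hg : fr.Good x y
    · obtain ⟨t, A, B⟩ := fr
      have hAB : A x = B y := hg
      cases t with
      | leaf z => simp [remainingSteps, hg, EqProtocol.depth] at hp0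
      | node a b l r =>
        have hout := hS.output_mem _ List.mem_cons_self hg
        simp only [remainingSteps, hg, if_true, EqProtocol.depth] at hp
        simp only [EqProtocol.output] at hout
        by_cases hab : a x = b y
        · rw [if_pos hab] at hout
          -- A true equality is always accepted, so this step cannot fail.
          refine ⟨∅, by simp, fun h => ⟨⟨r, fun x => a x :: A x, fun y => b y :: B y⟩ ::
            ⟨.node a b l r, A, B⟩ :: S, hS.cons fun _ => hout, ?_, fun hs => ?_⟩⟩
          · have hg' : Frame.Good (⟨r, fun x => a x :: A x, fun y => b y :: B y⟩ : Frame 𝒳 𝒴 𝒵) x y :=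
              congrArg₂ List.cons hab hAB
            simp only [remainingSteps, hg', if_true, Finset.notMem_empty, if_false]
            omega
          · simp [Protocol.walk, Protocol.output_hashTest, hAB, hab]
        · rw [if_neg hab] at hout
          refine ⟨_, hcoll a b hab, fun h => ?_⟩
          by_cases hc : h {x' | a x' = a x} = h {x' | a x' = b y}
          · have hg' : ¬Frame.Good
                (⟨r, fun x => a x :: A x, fun y => b y :: B y⟩ : Frame 𝒳 𝒴 𝒵) x y :=
              fun h' => hab (List.cons.inj h').1
            refine ⟨⟨r, fun x => a x :: A x, fun y => b y :: B y⟩ ::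
              ⟨.node a b l r, A, B⟩ :: S, hS.cons fun h' => absurd h' hg', ?_, fun hs => ?_⟩
            · simp only [remainingSteps, hg, hg', EqProtocol.depth, Finset.mem_filter,
                Finset.mem_univ, true_and, hc, if_true, if_false]
              omega
            · simp [Protocol.walk, Protocol.output_hashTest, hAB, hc]
          · refine ⟨⟨l, A, B⟩ :: ⟨.node a b l r, A, B⟩ :: S, hS.cons fun _ => hout, ?_, fun hs => ?_⟩
            · have hg' : Frame.Good (⟨l, A, B⟩ : Frame 𝒳 𝒴 𝒵) x y := hAB
              simp only [remainingSteps, hg', Finset.mem_filter,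
                Finset.mem_univ, true_and, hc, if_true, if_false]
              omega
            · simp [Protocol.walk, Protocol.output_hashTest, hAB, hc]
    · simp only [remainingSteps, hg, if_false] at hp
      refine ⟨_, hcoll fr.left fr.right hg, fun h => ?_⟩
      by_cases hc : h {x' | fr.left x' = fr.left x} = h {x' | fr.left x' = fr.right y}
      -- A missed bad frame: whatever the query does, at most one further bad frame is pushed.
      · simp only [Finset.mem_filter, Finset.mem_univ, true_and, hc, if_true]
        obtain ⟨t, A, B⟩ := fr
        dsimp only at hc
        cases t with
        | leaf z =>
          refine ⟨_, hS, ?_, fun hs => ?_⟩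
          · simp only [remainingSteps, hg, if_false]
            omega
          · simp [Protocol.walk, Protocol.output_hashTest, hc]
        | node a b l r =>
          by_cases hq : h {x' | a x' = a x} = h {x' | a x' = b y}
          · have hg' : ¬Frame.Good
                (⟨r, fun x => a x :: A x, fun y => b y :: B y⟩ : Frame 𝒳 𝒴 𝒵) x y :=
              fun h' => hg (List.cons.inj h').2
            refine ⟨⟨r, fun x => a x :: A x, fun y => b y :: B y⟩ ::
              ⟨.node a b l r, A, B⟩ :: S, hS.cons fun h' => absurd h' hg', ?_, fun hs => ?_⟩
            · simp only [remainingSteps, hg, hg', if_false]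
              omega
            · simp [Protocol.walk, Protocol.output_hashTest, hc, hq]
          · have hg' : ¬Frame.Good (⟨l, A, B⟩ : Frame 𝒳 𝒴 𝒵) x y := hg
            refine ⟨⟨l, A, B⟩ :: ⟨.node a b l r, A, B⟩ :: S,
              hS.cons fun h' => absurd h' hg', ?_, fun hs => ?_⟩
            · simp only [remainingSteps, hg, hg', if_false]
              omega
            · simp [Protocol.walk, Protocol.output_hashTest, hc, hq]
      · refine ⟨S, hS.tail hg, ?_, fun hs => ?_⟩
        · simp only [Finset.mem_filter, Finset.mem_univ, true_and, hc, if_false]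
          omega
        · simp [Protocol.walk, Protocol.output_hashTest, hc]

open Classical in
/-- The number of bad sequences of hash functions for the walk. -/
theorem card_bad_walk_le {𝒳 𝒴 𝒵 : Type} [Fintype 𝒳] (z₀ : 𝒵) {x : 𝒳} {y : 𝒴} {W : Set 𝒵}
    (T : ℕ) {S : List (Frame 𝒳 𝒴 𝒵)} (hS : SoundStack x y W S) {p : ℕ}
    (hp : remainingSteps x y S ≤ p) :
    (∑ ω : Fin T → Hash 𝒳,
      if (Protocol.walk z₀ (List.ofFn ω) S).output x y ∈ W then 0 else 1) * 2 ^ T ≤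
      4 ^ p * Fintype.card (Hash 𝒳) ^ T := by
  induction T generalizing S p with
  | zero =>
    simp only [Finset.univ_unique, Finset.sum_singleton, pow_zero, mul_one]
    exact le_trans (by split_ifs <;> simp) (Nat.one_le_pow p 4 (by norm_num))
  | succ T ih =>
    by_cases hp0 : remainingSteps x y S = 0
    · simp [output_walk_of_remainingSteps_eq_zero z₀ hS hp0]
    · obtain ⟨p, rfl⟩ : ∃ q, p = q + 1 := ⟨p - 1, by omega⟩
      obtain ⟨bad, hbad, hnext⟩ := exists_next_stack z₀ hS hp hp0
      choose S' hS' hrem hout using hnext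
      have hsum : (∑ ω : Fin (T + 1) → Hash 𝒳,
          if (Protocol.walk z₀ (List.ofFn ω) S).output x y ∈ W then 0 else 1) =
          ∑ h : Hash 𝒳, ∑ ω : Fin T → Hash 𝒳,
            if (Protocol.walk z₀ (List.ofFn ω) (S' h)).output x y ∈ W then 0 else 1 := by
        rw [← (Fin.consEquiv fun _ => Hash 𝒳).sum_comp, Fintype.sum_prod_type]
        refine Finset.sum_congr rfl fun h _ => Finset.sum_congr rfl fun ω _ => ?_
        rw [← hout]
        simp [Fin.consEquiv, List.ofFn_succ]
      set N := Fintype.card (Hash 𝒳) with hN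
      have hle : ∀ h, (∑ ω : Fin T → Hash 𝒳,
            if (Protocol.walk z₀ (List.ofFn ω) (S' h)).output x y ∈ W then 0 else 1) * 2 ^ T ≤
          ((if h ∈ bad then 16 * 4 ^ p else 0) + 4 ^ p) * N ^ T := by
        intro h
        refine (ih (hS' h) (hrem h)).trans (Nat.mul_le_mul_right _ ?_)
        split_ifs
        · rw [pow_add]
          omega
        · simp
      -- A bad hash gives `4 ^ (p + 2) = 16 * 4 ^ p`, and at most `1/16` of them are bad. So the
      -- mean potential is at most `2 * 4 ^ p`, half of `4 ^ (p + 1)`.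
      calc _ = (∑ h : Hash 𝒳, (∑ ω : Fin T → Hash 𝒳,
              if (Protocol.walk z₀ (List.ofFn ω) (S' h)).output x y ∈ W then 0 else 1) * 2 ^ T)
              * 2 := by rw [hsum, Finset.sum_mul, Finset.sum_mul]; simp only [pow_succ, mul_assoc]
        _ ≤ (∑ h : Hash 𝒳, ((if h ∈ bad then 16 * 4 ^ p else 0) + 4 ^ p) * N ^ T) * 2 :=
            Nat.mul_le_mul_right _ (Finset.sum_le_sum fun h _ => hle h)
        _ = ((16 * bad.card + N) * 4 ^ p * N ^ T) * 2 := by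
            rw [← Finset.sum_mul, Finset.sum_add_distrib, Finset.sum_ite_mem, Finset.univ_inter,
              Finset.sum_const, Finset.sum_const, Finset.card_univ, ← hN]
            simp only [smul_eq_mul]
            ring
        _ ≤ ((N + N) * 4 ^ p * N ^ T) * 2 := by gcongr
        _ = _ := by ring

/-! ### From public to private coins -/

open Classical in
/-- A probability bound `4 ^ (-K)` for the bad outcomes of each of fewer than `2 ^ |J|` inputs gives
`|J|` samples such that for every input fewer than a fraction `1 / K` of them is bad. -/
theorem exists_samples {I Ω J : Type} [Fintype I] [Fintype Ω] [Nonempty Ω] [Fintype J]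
    (bad : I → Ω → Prop) (K : ℕ)
    (hbad : ∀ i, (Finset.univ.filter (bad i)).card * 4 ^ K ≤ Fintype.card Ω)
    (hIJ : Fintype.card I < 2 ^ Fintype.card J) :
    ∃ σ : J → Ω, ∀ i, K * (Finset.univ.filter fun j => bad i (σ j)).card < Fintype.card J := by
  by_contra! hcon
  set N := Fintype.card J with hN
  set M := Fintype.card Ω with hM
  have hMpos : 0 < M := Fintype.card_pos
  -- Exponential moment: `4 ^ K` per bad sample has mean at most `2`, so `|J|` independent samples
  -- give at most `2 ^ |J|` per input. A failing `σ` would contribute `4 ^ |J|`, too much for fewer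
  -- than `2 ^ |J|` inputs.
  have hone : ∀ i, ∑ ω, (if bad i ω then 4 ^ K else 1) ≤ 2 * M := by
    intro i
    calc ∑ ω, (if bad i ω then 4 ^ K else 1) ≤ ∑ ω, ((if bad i ω then 4 ^ K else 0) + 1) :=
          Finset.sum_le_sum fun ω _ => by split_ifs <;> simp
      _ = (Finset.univ.filter (bad i)).card * 4 ^ K + M := by
          rw [Finset.sum_add_distrib, ← Finset.sum_filter]
          simp [hM]
      _ ≤ 2 * M := by linarith [hbad i]
  have hprod : ∀ i, ∑ σ : J → Ω, ∏ j, (if bad i (σ j) then 4 ^ K else 1) ≤ (2 * M) ^ N := by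
    intro i
    rw [← Fintype.piFinset_univ, ← Finset.prod_univ_sum (fun _ => Finset.univ)
      (fun _ ω => if bad i ω then 4 ^ K else 1)]
    simpa [hN] using Nat.pow_le_pow_left (hone i) N
  have hlow : ∀ σ : J → Ω, 4 ^ N ≤ ∑ i, ∏ j, (if bad i (σ j) then 4 ^ K else 1) := by
    intro σ
    obtain ⟨i, hi⟩ := hcon σ
    refine le_trans ?_ (Finset.single_le_sum
      (f := fun i => ∏ j, (if bad i (σ j) then 4 ^ K else 1))
      (fun _ _ => Nat.zero_le _) (Finset.mem_univ i))
    rw [← Finset.prod_filter, Finset.prod_const, ← pow_mul]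
    exact Nat.pow_le_pow_right (by norm_num) hi
  have h1 : M ^ N * 4 ^ N ≤ Fintype.card I * (2 * M) ^ N :=
    calc M ^ N * 4 ^ N = ∑ _σ : J → Ω, 4 ^ N := by simp [hM, hN]
      _ ≤ ∑ σ : J → Ω, ∑ i, ∏ j, (if bad i (σ j) then 4 ^ K else 1) :=
          Finset.sum_le_sum fun σ _ => hlow σ
      _ = ∑ i, ∑ σ : J → Ω, ∏ j, (if bad i (σ j) then 4 ^ K else 1) := Finset.sum_comm
      _ ≤ ∑ _i : I, (2 * M) ^ N := Finset.sum_le_sum fun i _ => hprod i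
      _ = Fintype.card I * (2 * M) ^ N := by simp
  have h2 : Fintype.card I * (2 * M) ^ N < 2 ^ N * (2 * M) ^ N := by gcongr
  have h3 : 2 ^ N * (2 * M) ^ N = M ^ N * 4 ^ N := by
    rw [← mul_pow, ← mul_pow]
    ring
  omega

/-- The protocol in which the players apply `u` and `v` to their inputs first. -/
def Protocol.comap {𝒳 𝒴 𝒳' 𝒴' 𝒵 : Type} (u : 𝒳' → 𝒳) (v : 𝒴' → 𝒴) :
    Protocol 𝒳 𝒴 𝒵 → Protocol 𝒳' 𝒴' 𝒵
  | .leaf z => .leaf z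
  | .alice f l r => .alice (fun x => f (u x)) (l.comap u v) (r.comap u v)
  | .bob g l r => .bob (fun y => g (v y)) (l.comap u v) (r.comap u v)

theorem Protocol.cost_comap {𝒳 𝒴 𝒳' 𝒴' 𝒵 : Type} (u : 𝒳' → 𝒳) (v : 𝒴' → 𝒴)
    (P : Protocol 𝒳 𝒴 𝒵) : (P.comap u v).cost = P.cost := by
  induction P <;> simp_all [Protocol.comap, Protocol.cost]

theorem Protocol.output_comap {𝒳 𝒴 𝒳' 𝒴' 𝒵 : Type} (u : 𝒳' → 𝒳) (v : 𝒴' → 𝒴)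
    (P : Protocol 𝒳 𝒴 𝒵) (x : 𝒳') (y : 𝒴') :
    (P.comap u v).output x y = P.output (u x) (v y) := by
  induction P <;> simp_all [Protocol.comap, Protocol.output]

/-- Alice sends `s` bits which select the protocol that is used. -/
theorem Protocol.exists_select {𝒳 𝒴 𝒵 : Type} (s c : ℕ) (f : 𝒳 → Fin s → Bool)
    (P : (Fin s → Bool) → Protocol 𝒳 𝒴 𝒵) (hP : ∀ ρ, (P ρ).cost ≤ c) :
    ∃ Q : Protocol 𝒳 𝒴 𝒵, Q.cost ≤ c + s ∧ ∀ x y, Q.output x y = (P (f x)).output x y := by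
  induction s with
  | zero => exact ⟨P Fin.elim0, hP _, fun x y => by rw [Subsingleton.elim (f x) Fin.elim0]⟩
  | succ s ih =>
    obtain ⟨Q₀, hQ₀, h₀⟩ := ih (fun x => Fin.tail (f x)) (fun ρ => P (Fin.cons false ρ))
      fun ρ => hP _
    obtain ⟨Q₁, hQ₁, h₁⟩ := ih (fun x => Fin.tail (f x)) (fun ρ => P (Fin.cons true ρ))
      fun ρ => hP _
    refine ⟨.alice (fun x => f x 0) Q₀ Q₁, ?_, fun x y => ?_⟩
    · simp only [Protocol.cost]
      omega
    · have hf := Fin.cons_self_tail (f x)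
      simp only [Protocol.output, h₀, h₁]
      cases h : f x 0 <;> rw [h] at hf <;> simp [hf]

/-- The walk takes `T = 2 * E.depth + 2 * K` steps, so its failure probability is at most `4 ^
E.depth / 2 ^ T = 4 ^ (-K)`, as sampling requires. Alice's `k` coins select one of `2 ^ k` samples
and are sent to Bob, who tosses none. -/
theorem EqProtocol.exists_randomizedProtocol {𝒳 𝒴 𝒵 : Type} [Fintype 𝒳] [Fintype 𝒴]
    {R : Set (𝒳 × 𝒴 × 𝒵)} (E : EqProtocol 𝒳 𝒴 𝒵) (hE : ∀ x y, (x, y, E.output x y) ∈ R)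
    (k K : ℕ) (hK : 0 < K) (hk : Fintype.card (𝒳 × 𝒴) < 2 ^ 2 ^ k) :
    ∃ Q : RandomizedProtocol 𝒳 𝒴 𝒵, Q.SolvesWithError R (1 / K) ∧
      Q.cost ≤ 16 * (2 * E.depth + 2 * K) + k := by
  classical
  set T := 2 * E.depth + 2 * K with hT
  let S : List (Frame 𝒳 𝒴 𝒵) := [⟨E, fun _ => [], fun _ => []⟩]
  let P : (Fin T → Hash 𝒳) → Protocol 𝒳 𝒴 𝒵 := fun ω =>
    Protocol.walk E.leftmost (List.ofFn ω) S
  have hcost : ∀ ω, (P ω).cost ≤ 16 * T := fun ω => by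
    simpa using Protocol.cost_walk E.leftmost (List.ofFn ω) S
  obtain ⟨σ, hσ⟩ := exists_samples (J := Fin k → Bool)
    (fun (q : 𝒳 × 𝒴) ω => (q.1, q.2, (P ω).output q.1 q.2) ∉ R) K (by
      rintro ⟨x, y⟩
      have hgood : Frame.Good (⟨E, fun _ => [], fun _ => []⟩ : Frame 𝒳 𝒴 𝒵) x y := rfl
      have hS : SoundStack x y {z | (x, y, z) ∈ R} S :=
        ⟨by simpa [S] using fun _ => hE x y, ⟨_, List.mem_singleton_self _, hgood⟩⟩
      have := card_bad_walk_le E.leftmost T hS (p := E.depth) (by simp [S, remainingSteps, hgood])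
      rw [hT, pow_add, pow_mul, pow_mul 2 2 K, ← hT] at this
      norm_num only at this
      rw [Finset.card_filter, Fintype.card_fun, Fintype.card_fin]
      refine Nat.le_of_mul_le_mul_left ?_ (show 0 < 4 ^ E.depth by positivity)
      refine le_trans (le_of_eq ?_) this
      rw [mul_left_comm]
      congr 1
      refine Finset.sum_congr rfl fun ω _ => ?_
      by_cases h : (x, y, (P ω).output x y) ∈ R
      · rw [if_neg (not_not_intro h), if_pos (show _ ∈ {z | (x, y, z) ∈ R} from h)]
      · rw [if_pos h, if_neg (show _ ∉ {z | (x, y, z) ∈ R} from h)]) (by simpa using hk)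
  obtain ⟨Q, hQ, hout⟩ := Protocol.exists_select
    (𝒳 := 𝒳 × (Fin k → Bool)) (𝒴 := 𝒴 × (Fin 0 → Bool)) k (16 * T) Prod.snd
    (fun ρ => (P (σ ρ)).comap Prod.fst Prod.fst)
    (fun ρ => by rw [Protocol.cost_comap]; exact hcost _)
  refine ⟨⟨k, 0, Q⟩, fun x y => ?_, hQ⟩
  have hlt := hσ (x, y)
  simp only [RandomizedProtocol.errorProb, hout, Protocol.output_comap]
  have hle : (Finset.univ.filter fun ρ : (Fin k → Bool) × (Fin 0 → Bool) =>
      (x, y, (P (σ ρ.1)).output x y) ∉ R).card ≤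
      (Finset.univ.filter fun j => (x, y, (P (σ j)).output x y) ∉ R).card := by
    refine Finset.card_le_card_of_injOn Prod.fst (fun ρ hρ => by simpa using hρ) ?_
    rintro ⟨a, b⟩ - ⟨a', b'⟩ - rfl
    rw [Subsingleton.elim b b']
  have hfin : K * (Finset.univ.filter fun ρ : (Fin k → Bool) × (Fin 0 → Bool) =>
      (x, y, (P (σ ρ.1)).output x y) ∉ R).card ≤ 2 ^ k := by
    simp only [Fintype.card_fun, Fintype.card_bool, Fintype.card_fin] at hlt
    exact (Nat.mul_le_mul_left K hle).trans hlt.le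
  rw [div_le_div_iff₀ (by positivity) (by exact_mod_cast hK), one_mul, add_zero, mul_comm]
  exact_mod_cast hfin

/-! ### ### Constants and conclusion -/

theorem clog_two_add_two_le {n : ℕ} (hn : 2 ≤ n) : (Nat.clog 2 (n + 2) : ℝ) ≤ 3 * Real.logb 2 n := by
  have h1 : 1 ≤ Real.logb 2 n := by
    rw [Real.le_logb_iff_rpow_le one_lt_two (by positivity)]
    simpa using (by exact_mod_cast hn : (2 : ℝ) ≤ n)
  have h2 : Nat.clog 2 (n + 2) ≤ Nat.log 2 n + 2 := by
    refine Nat.clog_le_of_le_pow ?_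
    have := Nat.lt_pow_succ_log_self one_lt_two n
    rw [pow_succ 2 (Nat.log 2 n + 1)]
    omega
  have h3 : (Nat.log 2 n : ℝ) ≤ Real.logb 2 n := Real.natLog_le_logb n 2
  have h4 : (Nat.clog 2 (n + 2) : ℝ) ≤ Nat.log 2 n + 2 := by exact_mod_cast h2
  linarith

end StabbingPlanes

open StabbingPlanes
theorem lemma5p3 :
    ∃ (C : ℝ) (D : ℝ → ℝ), ∀ (n m : ℕ) (_hn : 2 ≤ n) (F : StabbingPlanes.CNF n m)
      (_hF : F.Unsatisfiable) (X Y : Finset (Fin n)) (_hXY : IsCompl X Y)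
      (T : ThresholdTree n) (_hT : T.IsRefutation F.system),
      (∃ P : RealProtocol (X → Bool) (Y → Bool) (Fin m),
        P.Solves (Search F X Y) ∧ (P.cost : ℝ) ≤ C * (T.rank + Real.logb 2 n)) ∧
      (∀ ε : ℝ, 0 < ε → ∃ Q : RandomizedProtocol (X → Bool) (Y → Bool) (Fin m),
        Q.SolvesWithError (Search F X Y) ε ∧
        (Q.cost : ℝ) ≤ D ε * (T.rank * Real.logb 2 n + Real.logb 2 n ^ 2)) := by
  -- With `ℓ = log₂ n` and `K = ⌈1 / ε⌉`, the cost is at most `32 * (r + 3ℓ) * 4ℓ + 32 * K + 3ℓ`;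
  -- since `ℓ ≥ 1`, the constant `400` covers `384 + 3`.
  refine ⟨3, fun ε => 400 + 32 * ⌈1 / ε⌉₊, fun n m hn F hF X Y hXY T hT => ?_⟩
  obtain ⟨P, hP, hPcost⟩ := exists_realProtocol_of_isRefutation hF hXY hT
  have hk := clog_two_add_two_le hn
  set k := Nat.clog 2 (n + 2)
  set ℓ := Real.logb 2 n with hℓ
  have hℓ1 : 1 ≤ ℓ := by
    rw [hℓ, Real.le_logb_iff_rpow_le one_lt_two (by positivity)]
    simpa using (by exact_mod_cast hn : (2 : ℝ) ≤ n)
  have hr : (0 : ℝ) ≤ T.rank := Nat.cast_nonneg _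
  have hcost : (P.cost : ℝ) ≤ T.rank + 3 * ℓ := by
    have : (P.cost : ℝ) ≤ T.rank + k := by exact_mod_cast hPcost
    linarith
  refine ⟨⟨P, hP, by linarith⟩, fun ε hε => ?_⟩
  -- One `k` serves twice: `2 ^ n < 2 ^ 2 ^ k` bounds both Alice's ranks and the number of input
  -- pairs.
  have hnk : n < 2 ^ k := lt_of_lt_of_le (by omega) (Nat.le_pow_clog one_lt_two (n + 2))
  have hcard : X.card + Y.card = n := by
    rw [← Finset.card_union_of_disjoint hXY.disjoint, ← Finset.sup_eq_union, hXY.sup_eq_top]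
    simp
  obtain ⟨E, hE, hEout⟩ := P.exists_eqProtocol k (by
    rw [Fintype.card_fun, Fintype.card_bool, Fintype.card_coe]
    exact Nat.pow_lt_pow_right one_lt_two (lt_of_le_of_lt (by omega) hnk))
  have hKpos : 0 < ⌈1 / ε⌉₊ := Nat.ceil_pos.2 (by positivity)
  obtain ⟨Q, hQ, hQcost⟩ := E.exists_randomizedProtocol (R := Search F X Y)
    (fun x y => by rw [hEout]; exact hP x y) k ⌈1 / ε⌉₊ hKpos (by
    rw [Fintype.card_prod, Fintype.card_fun, Fintype.card_fun, Fintype.card_bool,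
      Fintype.card_coe, Fintype.card_coe, ← pow_add, hcard]
    exact Nat.pow_lt_pow_right one_lt_two hnk)
  refine ⟨Q, fun x y => (hQ x y).trans ?_, ?_⟩
  · rw [one_div_le (by exact_mod_cast hKpos) hε]
    exact Nat.le_ceil _
  · have h1 : (E.depth : ℝ) ≤ P.cost * (k + 1) := by exact_mod_cast hE
    have h2 : (Q.cost : ℝ) ≤ 16 * (2 * E.depth + 2 * ⌈1 / ε⌉₊) + k := by exact_mod_cast hQcost
    have hK0 : (0 : ℝ) ≤ ⌈1 / ε⌉₊ := Nat.cast_nonneg _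
    change _ ≤ (400 + 32 * (⌈1 / ε⌉₊ : ℝ)) * _
    generalize (⌈1 / ε⌉₊ : ℝ) = K at h2 hK0 ⊢
    have h3 : (P.cost : ℝ) * (k + 1) ≤ (T.rank + 3 * ℓ) * (4 * ℓ) := by
      gcongr
      linarith
    have hrl : 0 ≤ T.rank * ℓ := by positivity
    have hl2 : ℓ ≤ ℓ ^ 2 := by nlinarith
    have hKl : K ≤ K * (T.rank * ℓ + ℓ ^ 2) := le_mul_of_one_le_right hK0 (by linarith)
    nlinarith
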